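/- Setting. Consider a quantum system of finitely many sites, site $i$ having a finite-dimensional Hilbert space $\mathcal H_i$, with total space $\mathcal H=\bigotimes_i\mathcal H_i$. A Liouvillian is a linear map on the operators on $\mathcal H$ of the form $$\mathcal L[\rho]=-\mathrm i[H,\rho]+\sum_\mu\bigl(2L_\mu\rho L_\mu^\dagger-\{L_\mu^\dagger L_\mu,\rho\}\bigr),$$ with $H$ Hermitian and finitely many operators $L_\mu$. For a local operator $O$, let $O_j$ be the operator acting as $O$ on site $j$ and as the identity on the other sites (when two sites $j,k$ are compared, their local spaces are identified, so that $O$ acts on both), and for an initial density operator $\rho_0$ put $\langle O_j(t)\rangle=\operatorname{tr}(O_j\,e^{t\mathcal L}[\rho_0])$. Stable synchronization. Sites $j,k$ are stably synchronized in $O$ if for some initial density operator $\rho_0$ and some $\tau\ge 0$ we have $\langle O_j(t)\rangle=\langle O_k(t)\rangle$ for all $t\ge\tau$, while $\langle O_j(t)\rangle$ is not constant on $[\tau,\infty)$; here "equal" and "constant" mean up to an error bounded by $Ce^{-\gamma t}$ for some $C$ and $\gamma>0$. Metastable synchronization. Let $\mathcal L'(s)$ be a family of Liouvillians with a real parameter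 $s$ ranging over a set $S$ (for instance $S=\mathbb R$ or $S=[0,\infty)$). Sites $j,k$ are metastably synchronized in $O$ if there are initial density operators $\rho_0(s)$, times $0\le\tau(s)$ and $T(s)$ with $T(s)\to\infty$ and $\tau(s)/T(s)\to0$ as $s\to0$ in $S\setminus\{0\}$, and an error $\varepsilon(s)\to0$, such that, for the evolution $e^{t\mathcal L'(s)}[\rho_0(s)]$: (a) for some $C$ and $\gamma>0$ independent of $s$, $|\langle O_j(t)\rangle-\langle O_k(t)\rangle|\le Ce^{-\gamma t}+\varepsilon(s)$ for all small $s\in S\setminus\{0\}$ and all $t\in[\tau(s),T(s)]$; and (b) there are no constants $c(s)$, $C$, $\gamma>0$ ($C,\gamma$ independent of $s$) with $|\langle O_j(t)\rangle-c(s)|\le Ce^{-\gamma t}$ for all small $s\in S\setminus\{0\}$ and all $t\in[\tau(s),T(s)]$. Theorem 4. Let $\mathcal L$ be a Liouvillian given by $H$ and $(L_\mu)_\mu$. Suppose that there is a full-rank stationary state (an invertible density operator $\rho_\infty$ with $\mathcal L[\rho_\infty]=0$), and that the commutant of $\{H,L_\mu,L_\mu^\dagger\}$ is trivial, $\{H,L_\mu,L_\mu^\dagger\}'=\mathbb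 C\mathbf 1$. Then: 1. $\mathcal L$ has no nonzero purely imaginary eigenvalue. 2. No two sites are stably synchronized under $\mathcal L$, in any local operator $O$. 3. (The hypotheses hold at leading order.) Let $S\subseteq\mathbb R$ and let $\mathcal L'(s)$ be a family of linear maps on operators, analytic in $s$ at $s=0$, with $\mathcal L'(0)=\mathcal L$ and with $\mathcal L'(s)$ a Liouvillian for every $s\in S$. Then there are no almost purely imaginary eigenvalues: there is $\delta>0$ such that for all sufficiently small $s\in S\setminus\{0\}$ every nonzero eigenvalue $\lambda$ of $\mathcal L'(s)$ satisfies $\operatorname{Re}\lambda\le-\delta$. Moreover, no two sites are metastably synchronized in any local operator $O$. -/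

import Mathlib

open Filter Topology
open scoped ComplexOrder

noncomputable section

/-- A density operator (quantum state): positive semidefinite with unit trace. -/
def IsDensityOperator {n : Type*} [Fintype n] (ρ : Matrix n n ℂ) : Prop :=
  ρ.PosSemidef ∧ ρ.trace = 1

/-- The quantum Liouvillian with Hamiltonian `H` and jump operators `L μ`,
`ρ ↦ -i[H, ρ] + ∑ μ, (2 L_μ ρ L_μ† - {L_μ† L_μ, ρ})`, as a linear map on operators. -/
def liouvillian {n M : Type*} [Fintype n] [DecidableEq n] [Fintype M]
    (H : Matrix n n ℂ) (L : M → Matrix n n ℂ) : Module.End ℂ (Matrix n n ℂ) where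
  toFun ρ := (-Complex.I) • (H * ρ - ρ * H) +
    ∑ μ, ((2 : ℂ) • (L μ * ρ * (L μ).conjTranspose) -
      ((L μ).conjTranspose * L μ * ρ + ρ * ((L μ).conjTranspose * L μ)))
  map_add' ρ σ := by
    rw [add_add_add_comm, ← Finset.sum_add_distrib, ← smul_add]
    congr 1
    · congr 1
      simp only [mul_add, add_mul]
      abel
    · refine Finset.sum_congr rfl fun μ _ => ?_
      simp only [mul_add, add_mul, smul_add]
      abel
  map_smul' c ρ := by
    simp only [RingHom.id_apply, smul_add, Finset.smul_sum, Matrix.mul_smul, Matrix.smul_mul,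
      smul_sub, smul_comm c]

/-- A linear map on operators that is a quantum Liouvillian for some Hermitian Hamiltonian and
some finite family of jump operators. -/
def IsLiouvillian {n : Type*} [Fintype n] [DecidableEq n]
    (𝓛 : Module.End ℂ (Matrix n n ℂ)) : Prop :=
  ∃ (H : Matrix n n ℂ) (m : ℕ) (L : Fin m → Matrix n n ℂ),
    H.IsHermitian ∧ 𝓛 = liouvillian H L

/-- The commutant `{H, L_μ, L_μ†}'`. -/
def commutant {n M : Type*} [Fintype n] (H : Matrix n n ℂ) (L : M → Matrix n n ℂ) :
    Set (Matrix n n ℂ) :=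
  Set.centralizer ({H} ∪ Set.range L ∪ Set.range fun μ => (L μ).conjTranspose)

/-- The evolution `exp (t 𝓛)` generated by `𝓛`. The exponential is taken of the matrix of `t 𝓛` in
the basis of matrix units. -/
def evolution {n : Type*} [Fintype n] [DecidableEq n]
    (𝓛 : Module.End ℂ (Matrix n n ℂ)) (t : ℝ) : Module.End ℂ (Matrix n n ℂ) :=
  Matrix.toLin (Matrix.stdBasis ℂ n n) (Matrix.stdBasis ℂ n n)
    (NormedSpace.exp ((t : ℂ) •
      LinearMap.toMatrix (Matrix.stdBasis ℂ n n) (Matrix.stdBasis ℂ n n) 𝓛))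

/-- The expectation value `⟨O(t)⟩ = tr (O exp(t 𝓛)[ρ₀])`. -/
def expectation {n : Type*} [Fintype n] [DecidableEq n] (𝓛 : Module.End ℂ (Matrix n n ℂ))
    (O ρ₀ : Matrix n n ℂ) (t : ℝ) : ℂ :=
  (O * evolution 𝓛 t ρ₀).trace

/-- The operator `1 ⊗ ⋯ ⊗ O ⊗ ⋯ ⊗ 1` acting as `O` on site `j`. The site `i` has a Hilbert space
with orthonormal basis indexed by `κ i`, and the total space has the product basis. -/
def siteOperator {ι : Type*} [Fintype ι] [DecidableEq ι] {κ : ι → Type*}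
    [∀ i, DecidableEq (κ i)] (j : ι) (O : Matrix (κ j) (κ j) ℂ) :
    Matrix (∀ i, κ i) (∀ i, κ i) ℂ :=
  Matrix.of fun x y => if ∀ i, i ≠ j → x i = y i then O (x j) (y j) else 0

/-- Subsystems `j` and `k`, whose local spaces are identified by `e`, are stably synchronized in
the local operator `O`: for some initial state, from some time `τ` on, `⟨O_j(t)⟩ = ⟨O_k(t)⟩`, and
`⟨O_j(t)⟩` is not constant. Equality and constancy are understood up to terms that are
exponentially small in time. -/
def StablySynchronized {ι : Type*} [Fintype ι] [DecidableEq ι] {κ : ι → Type*}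
    [∀ i, Fintype (κ i)] [∀ i, DecidableEq (κ i)]
    (𝓛 : Module.End ℂ (Matrix (∀ i, κ i) (∀ i, κ i) ℂ))
    (j k : ι) (e : κ j ≃ κ k) (O : Matrix (κ j) (κ j) ℂ) : Prop :=
  ∃ (ρ₀ : Matrix (∀ i, κ i) (∀ i, κ i) ℂ) (τ : ℝ),
    IsDensityOperator ρ₀ ∧ 0 ≤ τ ∧
    (∃ C γ : ℝ, 0 < γ ∧ ∀ t, τ ≤ t →
      ‖expectation 𝓛 (siteOperator j O) ρ₀ t -
        expectation 𝓛 (siteOperator k (O.reindex e e)) ρ₀ t‖ ≤ C * Real.exp (-γ * t)) ∧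
    ¬ ∃ (c : ℂ) (C γ : ℝ), 0 < γ ∧ ∀ t, τ ≤ t →
      ‖expectation 𝓛 (siteOperator j O) ρ₀ t - c‖ ≤ C * Real.exp (-γ * t)

/-- For a family `𝓛 s`, with perturbative parameter `s` ranging over `S`, the subsystems `j` and
`k` are metastably synchronized in `O`: for some initial states, on time intervals `[τ s, T s]`
with `T s ≫ τ s` and with a cut-off time `T s` that grows without bound as `s → 0`,
`⟨O_j(t)⟩ = ⟨O_k(t)⟩` and `⟨O_j(t)⟩` is not constant. Equality is understood up to terms that are
exponentially small in time, uniformly in `s`, and up to an error `ε s` that vanishes with the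
perturbation (`ε = 0` is exact equality up to exponentially small terms); constancy is understood
up to terms that are exponentially small in time, uniformly in `s`. -/
def MetastablySynchronized {ι : Type*} [Fintype ι] [DecidableEq ι] {κ : ι → Type*}
    [∀ i, Fintype (κ i)] [∀ i, DecidableEq (κ i)]
    (𝓛 : ℝ → Module.End ℂ (Matrix (∀ i, κ i) (∀ i, κ i) ℂ)) (S : Set ℝ)
    (j k : ι) (e : κ j ≃ κ k) (O : Matrix (κ j) (κ j) ℂ) : Prop :=
  ∃ (ρ₀ : ℝ → Matrix (∀ i, κ i) (∀ i, κ i) ℂ) (τ T ε : ℝ → ℝ),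
    (∀ s, IsDensityOperator (ρ₀ s)) ∧ (∀ s, 0 ≤ τ s) ∧
    Tendsto T (𝓝[S \ {0}] 0) atTop ∧
    Tendsto (fun s => τ s / T s) (𝓝[S \ {0}] 0) (𝓝 0) ∧
    Tendsto ε (𝓝[S \ {0}] 0) (𝓝 0) ∧
    (∃ C γ : ℝ, 0 < γ ∧ ∀ᶠ s in 𝓝[S \ {0}] 0, ∀ t ∈ Set.Icc (τ s) (T s),
      ‖expectation (𝓛 s) (siteOperator j O) (ρ₀ s) t -
        expectation (𝓛 s) (siteOperator k (O.reindex e e)) (ρ₀ s) t‖ ≤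
          C * Real.exp (-γ * t) + ε s) ∧
    ¬ ∃ (c : ℝ → ℂ) (C γ : ℝ), 0 < γ ∧
      ∀ᶠ s in 𝓝[S \ {0}] 0, ∀ t ∈ Set.Icc (τ s) (T s),
        ‖expectation (𝓛 s) (siteOperator j O) (ρ₀ s) t - c s‖ ≤ C * Real.exp (-γ * t)

/-- The family `𝓛 s`, `s ∈ S`, has almost purely imaginary eigenvalues: for `s` arbitrarily close
to `0` (and different from `0`), `𝓛 s` has nonzero eigenvalues whose real part is above `-δ`, for
every `δ > 0`. The eigenvalue `0`, which every Liouvillian has, is excluded; slow real eigenvalues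
are included, so that the absence of such eigenvalues is a spectral gap uniform in `s`. -/
def HasAlmostPurelyImaginaryEigenvalues {n : Type*}
    (𝓛 : ℝ → Module.End ℂ (Matrix n n ℂ)) (S : Set ℝ) : Prop :=
  ∀ δ : ℝ, 0 < δ → ∃ᶠ s in 𝓝[S \ {0}] 0,
    ∃ z : ℂ, (𝓛 s).HasEigenvalue z ∧ z ≠ 0 ∧ -δ < z.re

end

/-! Faithfulness of the stationary state `ρ` and triviality of the commutant make `0` a simple
eigenvalue and put the rest of the spectrum in `Re z < 0`. Subtracting the rank-one map `X ↦ tr(X)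
ρ` moves `0` to `-1`, so the shifted generator `B` is exponentially stable
(`re_neg_of_mem_spectrum_shiftedGenerator`).

Exponential stability is an open condition with locally uniform constants
(`exists_eventually_norm_exp_smul_le`), so it survives perturbation. As a Liouvillian `A` has
traceless range, `B A = A A`, whence `exp (t A)` is a constant plus `exp (t B) B⁻¹ A`
(`exp_smul_eq_of_mul_self_eq`). Every expectation value is thus a constant plus an exponentially
small term, uniformly in small `s` and in the initial state. This contradicts the non-constancy in
both notions of synchronization. Nonzero eigenvalues of `A` are eigenvalues of `B`, which gives the
spectral gap. -/

/-! ### Uniform exponential stability in a Banach algebra -/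

section BanachAlgebra

variable {𝔸 : Type*} [NormedRing 𝔸] [NormedAlgebra ℂ 𝔸] [CompleteSpace 𝔸]

/-- A short Euler step turns the half-plane condition into a unit-disc condition: `|1 + h z|² = 1 +
2 h Re z + h² |z|²`, and compactness bounds `Re z` away from `0` and `|z|` from above. -/
theorem exists_smul_norm_one_add_lt_one {K : Set ℂ} (hK : IsCompact K)
    (hre : ∀ z ∈ K, z.re < 0) : ∃ h : ℝ, 0 < h ∧ ∀ z ∈ K, ‖1 + (h : ℂ) * z‖ < 1 := by
  rcases K.eq_empty_or_nonempty with rfl | hne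
  · exact ⟨1, one_pos, by simp⟩
  obtain ⟨w, hw, hmax⟩ := hK.exists_isMaxOn hne Complex.continuous_re.continuousOn
  obtain ⟨R, hR⟩ := hK.isBounded.exists_norm_le
  have hwre := hre w hw
  have hden : 0 < R ^ 2 + 1 := by positivity
  have hh : 0 < -w.re / (R ^ 2 + 1) := div_pos (by linarith) hden
  refine ⟨-w.re / (R ^ 2 + 1), hh, fun z hz => ?_⟩
  set h := -w.re / (R ^ 2 + 1) with hdef
  have hheq : h * (R ^ 2 + 1) = -w.re := div_mul_cancel₀ _ hden.ne'
  have hzre : z.re ≤ w.re := hmax hz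
  have hzn : z.re ^ 2 + z.im ^ 2 ≤ R ^ 2 := by
    have := pow_le_pow_left₀ (norm_nonneg z) (hR z hz) 2
    rw [Complex.sq_norm, Complex.normSq_apply] at this
    linarith
  have key : ‖1 + (h : ℂ) * z‖ ^ 2 < 1 := by
    rw [Complex.sq_norm, Complex.normSq_apply]
    simp only [Complex.add_re, Complex.add_im, Complex.one_re, Complex.one_im,
      Complex.re_ofReal_mul, Complex.im_ofReal_mul]
    have h1 : h * (z.re ^ 2 + z.im ^ 2) < -2 * z.re := by
      nlinarith [mul_le_mul_of_nonneg_left hzn hh.le]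
    nlinarith [mul_lt_mul_of_pos_left h1 hh]
  nlinarith [norm_nonneg (1 + (h : ℂ) * z)]

/-- Gelfand's formula gives `‖b ^ n‖ ≤ r ^ n` for large `n`; the constant `C` absorbs the finitely
many remaining powers. -/
theorem exists_norm_pow_le_of_spectralRadius_lt_one {b : 𝔸} (hb : spectralRadius ℂ b < 1) :
    ∃ C r : ℝ, 0 < r ∧ r < 1 ∧ ∀ n, ‖b ^ n‖ ≤ C * r ^ n := by
  obtain ⟨r, hr1, hr2⟩ := ENNReal.lt_iff_exists_nnreal_btwn.1 hb
  have hr0 : 0 < r := by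
    have := pos_of_gt hr1
    exact_mod_cast this
  have hev : ∀ᶠ n : ℕ in atTop, ‖b ^ n‖ / (r : ℝ) ^ n ≤ 1 := by
    filter_upwards [(spectrum.pow_nnnorm_pow_one_div_tendsto_nhds_spectralRadius b).eventually
      (gt_mem_nhds hr1), eventually_gt_atTop 0] with n hn hn0
    rw [div_le_one (by positivity)]
    have h2 := ENNReal.rpow_le_rpow hn.le (Nat.cast_nonneg n)
    rw [← ENNReal.rpow_mul, one_div_mul_cancel (by positivity), ENNReal.rpow_one,
      ENNReal.rpow_natCast] at h2
    exact_mod_cast h2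
  obtain ⟨C, hC⟩ := (isBoundedUnder_of_eventually_le hev).bddAbove_range
  refine ⟨C, r, hr0, by exact_mod_cast hr2, fun n => ?_⟩
  have := hC ⟨n, rfl⟩
  rwa [div_le_iff₀ (by positivity)] at this

theorem norm_exp_smul_le_of_norm_pow_le {b : 𝔸} {C r : ℝ} (hb : ∀ n, ‖b ^ n‖ ≤ C * r ^ n)
    {u : ℝ} (hu : 0 ≤ u) : ‖NormedSpace.exp ((u : ℂ) • b)‖ ≤ C * Real.exp (u * r) := by
  have h1 := NormedSpace.exp_series_hasSum_exp' (𝕂 := ℂ) ((u : ℂ) • b)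
  have h2 : HasSum (fun n : ℕ => C * (((n.factorial : ℝ)⁻¹) • (u * r) ^ n))
      (C * Real.exp (u * r)) := by
    rw [Real.exp_eq_exp_ℝ]
    exact (NormedSpace.exp_series_hasSum_exp' (𝕂 := ℝ) (u * r)).mul_left C
  rw [← h1.tsum_eq]
  refine tsum_of_norm_bounded h2 fun n => ?_
  rw [smul_pow, norm_smul, norm_smul, norm_inv, norm_pow, Complex.norm_natCast,
    Complex.norm_real, Real.norm_of_nonneg hu, smul_eq_mul, mul_pow]
  calc _ ≤ (n.factorial : ℝ)⁻¹ * (u ^ n * (C * r ^ n)) := by gcongr; exact hb n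
    _ = _ := by ring

/-- With `b = 1 + h a` of spectral radius below `1`, `exp (u h a) = e^{-u} exp (u b)` has norm at
most `C e^{-(1 - r) u}`. -/
theorem exists_norm_exp_lt_half [Nontrivial 𝔸] {a : 𝔸} (ha : ∀ z ∈ spectrum ℂ a, z.re < 0) :
    ∃ T : ℝ, 0 < T ∧ ‖NormedSpace.exp ((T : ℂ) • a)‖ < 1 / 2 := by
  let _ := NormedAlgebra.restrictScalars ℚ ℂ 𝔸
  obtain ⟨h, hh, hlt⟩ := exists_smul_norm_one_add_lt_one (spectrum.isCompact (𝕜 := ℂ) a) ha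
  have hhC : (h : ℂ) ≠ 0 := by exact_mod_cast hh.ne'
  set b : 𝔸 := 1 + (h : ℂ) • a with hbdef
  have hb : spectralRadius ℂ b < 1 := by
    refine spectrum.spectralRadius_lt_of_forall_lt b (r := 1) fun w hw => ?_
    have hz : (w - 1) / h ∈ spectrum ℂ a := by
      rw [spectrum.mem_iff] at hw ⊢
      contrapose! hw
      have : algebraMap ℂ 𝔸 w - b =
          algebraMap ℂ 𝔸 h * (algebraMap ℂ 𝔸 ((w - 1) / h) - a) := by
        rw [mul_sub, ← map_mul, mul_div_cancel₀ _ hhC, hbdef, Algebra.smul_def, map_sub, map_one]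
        abel
      rw [this]
      exact ((isUnit_iff_ne_zero.2 hhC).map (algebraMap ℂ 𝔸)).mul hw
    have := hlt _ hz
    rw [mul_div_cancel₀ _ hhC, add_sub_cancel] at this
    exact_mod_cast this
  obtain ⟨C, r, -, hr1, hC⟩ := exists_norm_pow_le_of_spectralRadius_lt_one hb
  have hnorm : ∀ u : ℝ, 0 ≤ u →
      ‖NormedSpace.exp (((u * h : ℝ) : ℂ) • a)‖ ≤ C * Real.exp (-((1 - r) * u)) := by
    intro u hu
    have hdecomp : ((u * h : ℝ) : ℂ) • a = algebraMap ℂ 𝔸 (-u : ℝ) + (u : ℂ) • b := by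
      rw [hbdef, smul_add, smul_smul, Algebra.algebraMap_eq_smul_one, Complex.ofReal_neg, neg_smul,
        neg_add_cancel_left, Complex.ofReal_mul]
    rw [hdecomp, NormedSpace.exp_add_of_commute (Algebra.commutes _ _),
      ← NormedSpace.algebraMap_exp_comm, ← Complex.exp_eq_exp_ℂ, ← Algebra.smul_def, norm_smul,
      Complex.norm_exp_ofReal]
    calc _ ≤ Real.exp (-u) * (C * Real.exp (u * r)) := by
          gcongr; exact norm_exp_smul_le_of_norm_pow_le hC hu
      _ = _ := by rw [mul_left_comm, ← Real.exp_add]; ring_nf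
  have hlim : Tendsto (fun u : ℝ => C * Real.exp (-((1 - r) * u))) atTop (𝓝 0) := by
    have := (Real.tendsto_exp_neg_atTop_nhds_zero.comp
      (tendsto_id.const_mul_atTop (sub_pos.2 hr1))).const_mul C
    simpa using this
  obtain ⟨u, hu1, hu2⟩ := ((hlim.eventually (gt_mem_nhds (by norm_num : (0 : ℝ) < 1 / 2))).and
    (eventually_gt_atTop 0)).exists
  exact ⟨u * h, mul_pos hu2 hh, (hnorm u hu2.le).trans_lt hu1⟩

/-- If the spectrum of `a` lies in the open left half-plane, then `exp (t b)` decays exponentially,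
uniformly for `b` in a neighbourhood of `a`. -/
theorem exists_eventually_norm_exp_smul_le [Nontrivial 𝔸] {a : 𝔸}
    (ha : ∀ z ∈ spectrum ℂ a, z.re < 0) :
    ∃ C γ : ℝ, 0 ≤ C ∧ 0 < γ ∧ ∀ᶠ b in 𝓝 a, ∀ t : ℝ, 0 ≤ t →
      ‖NormedSpace.exp ((t : ℂ) • b)‖ ≤ C * Real.exp (-γ * t) := by
  let _ := NormedAlgebra.restrictScalars ℚ ℂ 𝔸
  -- A strict bound at the single time `T` is open in `b`, and the semigroup law propagates it to
  -- all times.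
  obtain ⟨T, hT, hhalf⟩ := exists_norm_exp_lt_half ha
  have hone : 1 ≤ ‖(1 : 𝔸)‖ := one_le_norm_one 𝔸
  set K := ‖a‖ + 1 with hK
  have hK0 : 0 ≤ K := by positivity
  set E := ‖(1 : 𝔸)‖ * Real.exp (T * K) with hE
  have hE0 : 0 ≤ E := by positivity
  refine ⟨2 * E, Real.log 2 / T, by positivity, by positivity, ?_⟩
  have hcont : ContinuousAt (fun b : 𝔸 => ‖NormedSpace.exp ((T : ℂ) • b)‖) a :=
    (NormedSpace.exp_continuous.comp (continuous_const_smul (T : ℂ))).norm.continuousAt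
  have hKnear : ∀ᶠ b in 𝓝 a, ‖b‖ < K :=
    continuous_norm.continuousAt.eventually (gt_mem_nhds (lt_add_one ‖a‖))
  filter_upwards [hcont.eventually (gt_mem_nhds hhalf), hKnear] with b hb hbK t ht
  -- The factor `‖1‖` is for `n = 0`: the norm of the unit may exceed `1`.
  have hpow : ∀ n : ℕ, ‖b ^ n‖ ≤ ‖(1 : 𝔸)‖ * K ^ n := by
    intro n
    rcases n.eq_zero_or_pos with rfl | hn
    · simp
    · calc _ ≤ ‖b‖ ^ n := norm_pow_le' b hn
        _ ≤ 1 * K ^ n := by rw [one_mul]; gcongr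
        _ ≤ _ := by gcongr
  have hsmall : ∀ u : ℝ, 0 ≤ u → u ≤ T → ‖NormedSpace.exp ((u : ℂ) • b)‖ ≤ E :=
    fun u hu huT => (norm_exp_smul_le_of_norm_pow_le hpow hu).trans (by rw [hE]; gcongr)
  set n := ⌊t / T⌋₊ with hn
  have hn1 : (n : ℝ) * T ≤ t := (le_div_iff₀ hT).1 (Nat.floor_le (by positivity))
  have hn2 : t < (n + 1) * T := (div_lt_iff₀ hT).1 (Nat.lt_floor_add_one _)
  have hdecomp : (t : ℂ) • b = ((t - n * T : ℝ) : ℂ) • b + n • ((T : ℂ) • b) := by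
    rw [← Nat.cast_smul_eq_nsmul ℂ, smul_smul, ← add_smul]
    push_cast
    ring_nf
  -- The factor `2` pays for the floor: `t / T` is bounded by `n + 1`, not by `n`.
  have hexp : (1 / 2 : ℝ) ^ n ≤ 2 * Real.exp (-(Real.log 2 / T) * t) := by
    have h1 : (1 / 2 : ℝ) ^ n = 2 * Real.exp (-(Real.log 2 * (n + 1))) := by
      rw [mul_add, mul_one, neg_add, Real.exp_add, Real.exp_neg (Real.log 2),
        Real.exp_log two_pos, mul_comm (Real.log 2), ← mul_neg, Real.exp_nat_mul, Real.exp_neg,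
        Real.exp_log two_pos]
      ring
    rw [h1]
    gcongr
    rw [neg_mul, neg_le_neg_iff, div_mul_eq_mul_div, div_le_iff₀ hT, mul_assoc]
    gcongr
  have hcomm : Commute (((t - n * T : ℝ) : ℂ) • b) (n • ((T : ℂ) • b)) :=
    (((Commute.refl b).smul_left _).smul_right _).smul_right _
  rw [hdecomp, NormedSpace.exp_add_of_commute hcomm, NormedSpace.exp_nsmul]
  calc _ ≤ E * (1 / 2) ^ n := by
        have hs := hsmall (t - n * T) (by linarith) (by linarith)
        rcases n.eq_zero_or_pos with h0 | h0
        · rw [h0] at hs ⊢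
          simpa using hs
        · refine (norm_mul_le _ _).trans ?_
          gcongr
          exact (norm_pow_le' _ h0).trans (by gcongr)
    _ ≤ E * (2 * Real.exp (-(Real.log 2 / T) * t)) := by gcongr
    _ = _ := by ring

/-- If `b a = a a` and `c` is a right inverse of `b`, then `exp (t a) - exp (t b) c a` does not
depend on `t`. -/
theorem exp_smul_eq_of_mul_self_eq {a b c : 𝔸} (hab : b * a = a * a)
    (hbc : b * c = 1) (t : ℂ) :
    NormedSpace.exp (t • a) = (1 - c * a) + NormedSpace.exp (t • b) * (c * a) := by
  have h1 := NormedSpace.exp_series_hasSum_exp' (𝕂 := ℂ) (t • a)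
  have h2 := (NormedSpace.exp_series_hasSum_exp' (𝕂 := ℂ) (t • b)).mul_right (c * a)
  have h3 : HasSum (fun n : ℕ => if n = 0 then 1 - c * a else 0) (1 - c * a) :=
    hasSum_ite_eq 0 _
  refine h1.unique ?_
  convert h3.add h2 using 2 with n
  -- The two exponential series agree from the first power on; the mismatch of the zeroth terms is
  -- the constant `1 - c a`.
  have hpow : ∀ n : ℕ, b ^ (n + 1) * (c * a) = a ^ (n + 1) := by
    intro n
    induction n with
    | zero => rw [zero_add, pow_one, pow_one, ← mul_assoc, hbc, one_mul]
    | succ n ih => rw [pow_succ', mul_assoc, ih, pow_succ', ← mul_assoc, hab, mul_assoc,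
        ← pow_succ', ← pow_succ']
  rcases n with _ | n
  · simp
  · simp only [smul_pow, smul_mul_assoc, hpow, Nat.succ_ne_zero, if_false, zero_add]

end BanachAlgebra

/-! ### The dual generator and its spectrum on the imaginary axis -/

section Liouvillian

open Matrix

variable {n M : Type*} [Fintype n] [Fintype M]

/-- The Heisenberg-picture generator dual to `liouvillian H L` under the trace pairing. -/
noncomputable def liouvillianDual (H : Matrix n n ℂ) (L : M → Matrix n n ℂ) (Y : Matrix n n ℂ) :
    Matrix n n ℂ :=
  Complex.I • (H * Y - Y * H) + ∑ μ, ((2 : ℂ) • ((L μ)ᴴ * Y * L μ) -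
    ((L μ)ᴴ * L μ * Y + Y * ((L μ)ᴴ * L μ)))

theorem liouvillianDual_conjTranspose {H : Matrix n n ℂ} (hH : H.IsHermitian)
    (L : M → Matrix n n ℂ) (Y : Matrix n n ℂ) :
    liouvillianDual H L Yᴴ = (liouvillianDual H L Y)ᴴ := by
  simp only [liouvillianDual, conjTranspose_add, conjTranspose_smul, conjTranspose_sub,
    conjTranspose_mul, hH.eq, conjTranspose_sum, conjTranspose_conjTranspose, Complex.star_def,
    Complex.conj_I, map_ofNat, mul_assoc, neg_smul, smul_sub]
  congr 1
  · abel
  · refine Finset.sum_congr rfl fun μ _ => ?_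
    congr 1
    abel

theorem trace_conjTranspose_mul_self_mul_nonneg {ρ : Matrix n n ℂ} (hρ : ρ.PosSemidef)
    (Z : Matrix n n ℂ) : 0 ≤ (Zᴴ * Z * ρ).trace := by
  rw [mul_assoc, trace_mul_comm]
  exact (hρ.mul_mul_conjTranspose_same Z).trace_nonneg

variable [DecidableEq n]

theorem trace_mul_liouvillian (H : Matrix n n ℂ) (L : M → Matrix n n ℂ) (Y X : Matrix n n ℂ) :
    (Y * liouvillian H L X).trace = (liouvillianDual H L Y * X).trace := by
  simp only [liouvillian, liouvillianDual, LinearMap.coe_mk, AddHom.coe_mk, mul_add, add_mul,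
    trace_add, Finset.mul_sum, Finset.sum_mul, trace_sum, mul_sub, sub_mul, trace_sub,
    Matrix.mul_smul, Matrix.smul_mul, trace_smul, smul_sub]
  have cyc : ∀ A B : Matrix n n ℂ, (Y * (A * X * B)).trace = (B * Y * A * X).trace := fun A B => by
    rw [← mul_assoc, trace_mul_comm, ← mul_assoc, ← mul_assoc]
  have cyc1 : ∀ A : Matrix n n ℂ, (Y * (A * X)).trace = (Y * A * X).trace := fun A => by
    rw [mul_assoc]
  have cyc2 : ∀ A : Matrix n n ℂ, (Y * (X * A)).trace = (A * Y * X).trace := fun A => by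
    rw [← mul_assoc, trace_mul_comm, ← mul_assoc]
  congr 1
  · rw [cyc1, cyc2]; simp only [neg_smul]; abel
  · refine Finset.sum_congr rfl fun μ _ => ?_
    rw [cyc, cyc1, cyc2]; ring

theorem liouvillianDual_one (H : Matrix n n ℂ) (L : M → Matrix n n ℂ) :
    liouvillianDual H L 1 = 0 := by
  simp [liouvillianDual, two_smul]

theorem trace_liouvillian (H : Matrix n n ℂ) (L : M → Matrix n n ℂ) (X : Matrix n n ℂ) :
    (liouvillian H L X).trace = 0 := by
  have := trace_mul_liouvillian H L 1 X
  rwa [liouvillianDual_one, one_mul, zero_mul, trace_zero] at this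

/-- The dissipation form of the dual generator. -/
theorem liouvillianDual_mul (H : Matrix n n ℂ) (L : M → Matrix n n ℂ) (Y : Matrix n n ℂ) :
    liouvillianDual H L (Yᴴ * Y) =
      liouvillianDual H L Yᴴ * Y + Yᴴ * liouvillianDual H L Y +
        ∑ μ, (2 : ℂ) • ((L μ * Y - Y * L μ)ᴴ * (L μ * Y - Y * L μ)) := by
  simp only [liouvillianDual, add_mul, mul_add, Finset.sum_mul, Finset.mul_sum, Matrix.smul_mul,
    Matrix.mul_smul]
  rw [add_add_add_comm, add_assoc, ← Finset.sum_add_distrib, ← Finset.sum_add_distrib, ← smul_add]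
  congr 1
  · congr 1
    noncomm_ring
  · refine Finset.sum_congr rfl fun μ _ => ?_
    simp only [conjTranspose_sub, conjTranspose_mul, two_smul]
    noncomm_ring

/-- The trace is that of the positive semidefinite `Z ρ Zᴴ`, which therefore vanishes; positive
definiteness of `ρ` then kills every `Zᴴ v`. -/
theorem trace_conjTranspose_mul_self_mul_eq_zero {ρ : Matrix n n ℂ} (hρ : ρ.PosSemidef)
    (hu : IsUnit ρ) {Z : Matrix n n ℂ} (h : (Zᴴ * Z * ρ).trace = 0) : Z = 0 := by
  rw [mul_assoc, trace_mul_comm, (hρ.mul_mul_conjTranspose_same Z).trace_eq_zero_iff] at h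
  have hpd := hρ.posDef_iff_isUnit.2 hu
  have hz : Zᴴ = 0 := by
    refine Matrix.ext_of_mulVec_single fun i => ?_
    by_contra hne
    rw [zero_mulVec] at hne
    have := hpd.dotProduct_mulVec_pos hne
    rw [mulVec_mulVec, star_mulVec, ← dotProduct_mulVec, mulVec_mulVec, conjTranspose_conjTranspose,
      ← mul_assoc, h] at this
    simp at this
  rw [← conjTranspose_conjTranspose Z, hz, conjTranspose_zero]

/-- Pairing the dissipation form of `Yᴴ Y` with the stationary state gives `0 = 2 Re z · tr(Yᴴ Y ρ)
+ 2 ∑ tr([L μ, Y]ᴴ [L μ, Y] ρ)`, where faithfulness makes the first trace positive and the others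
are nonnegative. -/
theorem dissipation_of_eigenvector
    {H : Matrix n n ℂ} (hH : H.IsHermitian) {L : M → Matrix n n ℂ} {ρ : Matrix n n ℂ}
    (hρ : ρ.PosSemidef) (hu : IsUnit ρ) (hstat : liouvillian H L ρ = 0)
    {Y : Matrix n n ℂ} {z : ℂ} (hY0 : Y ≠ 0)
    (hY : liouvillianDual H L Y = z • Y) :
    z.re ≤ 0 ∧ (z.re = 0 → ∀ μ, L μ * Y = Y * L μ) := by
  have h1 := trace_mul_liouvillian H L (Yᴴ * Y) ρ
  rw [hstat, mul_zero, trace_zero, liouvillianDual_mul, liouvillianDual_conjTranspose hH, hY,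
    conjTranspose_smul, Matrix.smul_mul, Matrix.mul_smul, ← add_smul, add_mul, Finset.sum_mul,
    Matrix.smul_mul, trace_add, trace_smul, trace_sum] at h1
  have hp0 := trace_conjTranspose_mul_self_mul_nonneg hρ Y
  have hp : 0 < (Yᴴ * Y * ρ).trace.re := by
    refine lt_of_le_of_ne (Complex.le_def.1 hp0).1 fun h => hY0 ?_
    refine trace_conjTranspose_mul_self_mul_eq_zero hρ hu (Complex.ext h.symm ?_)
    exact (Complex.le_def.1 hp0).2.symm
  have hq0 : ∀ μ, 0 ≤ ((L μ * Y - Y * L μ)ᴴ * (L μ * Y - Y * L μ) * ρ).trace := fun μ =>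
    trace_conjTranspose_mul_self_mul_nonneg hρ _
  have hre : 0 = 2 * z.re * (Yᴴ * Y * ρ).trace.re +
      ∑ μ, 2 * ((L μ * Y - Y * L μ)ᴴ * (L μ * Y - Y * L μ) * ρ).trace.re := by
    have := congrArg Complex.re h1
    simp only [Matrix.smul_mul, trace_smul, smul_eq_mul, Complex.add_re, Complex.re_sum,
      Complex.mul_re, Complex.star_def, Complex.conj_re, Complex.add_im, Complex.conj_im,
      Complex.zero_re, neg_add_cancel, zero_mul, sub_zero, Complex.re_ofNat, Complex.im_ofNat]
      at this
    rw [this]; ring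
  have hsum : ∀ μ ∈ Finset.univ,
      0 ≤ 2 * ((L μ * Y - Y * L μ)ᴴ * (L μ * Y - Y * L μ) * ρ).trace.re := fun μ _ =>
    mul_nonneg two_pos.le (Complex.le_def.1 (hq0 μ)).1
  refine ⟨?_, fun hz μ => ?_⟩
  · nlinarith [Finset.sum_nonneg hsum]
  · rw [hz, mul_zero, zero_mul, zero_add] at hre
    have := (Finset.sum_eq_zero_iff_of_nonneg hsum).1 hre.symm μ (Finset.mem_univ _)
    refine sub_eq_zero.1 (trace_conjTranspose_mul_self_mul_eq_zero hρ hu (Complex.ext ?_ ?_))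
    · simpa using this
    · exact (Complex.le_def.1 (hq0 μ)).2.symm

/-- With a faithful stationary state and trivial commutant, the eigenvalues of the dual generator
other than zero have negative real part, and the eigenvectors at zero are scalars. -/
theorem eigenvalue_liouvillianDual [Nonempty n]
    {H : Matrix n n ℂ} (hH : H.IsHermitian) {L : M → Matrix n n ℂ} {ρ : Matrix n n ℂ}
    (hρ : ρ.PosSemidef) (hu : IsUnit ρ) (hstat : liouvillian H L ρ = 0)
    (hcomm : commutant H L ⊆ Set.range fun c : ℂ => c • (1 : Matrix n n ℂ))
    {Y : Matrix n n ℂ} {z : ℂ} (hY0 : Y ≠ 0) (hY : liouvillianDual H L Y = z • Y) :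
    z.re < 0 ∨ z = 0 ∧ ∃ c : ℂ, Y = c • 1 := by
  -- The adjoint is also an eigenvector; its commutation with `L μ` yields that of `Y` with `(L
  -- μ)ᴴ`.
  have hY' : liouvillianDual H L Yᴴ = star z • Yᴴ := by
    rw [liouvillianDual_conjTranspose hH, hY, conjTranspose_smul]
  obtain ⟨h1, h2⟩ := dissipation_of_eigenvector hH hρ hu hstat hY0 hY
  obtain ⟨-, h4⟩ := dissipation_of_eigenvector hH hρ hu hstat
    (conjTranspose_eq_zero.not.2 hY0) hY'
  rcases h1.lt_or_eq with h | hz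
  · exact Or.inl h
  right
  replace h2 := h2 hz
  replace h4 := h4 (by simpa using hz)
  have h5 : ∀ μ, (L μ)ᴴ * Y = Y * (L μ)ᴴ := fun μ => by
    have := congrArg conjTranspose (h4 μ)
    rw [conjTranspose_mul, conjTranspose_mul, conjTranspose_conjTranspose] at this
    exact this.symm
  have h6 : ∀ μ, (L μ)ᴴ * Yᴴ = Yᴴ * (L μ)ᴴ := fun μ => by
    rw [← conjTranspose_mul, ← conjTranspose_mul, h2]
  -- an eigenvector commuting with the jump operators evolves unitarily
  have hunit : ∀ X : Matrix n n ℂ, (∀ μ, L μ * X = X * L μ) → (∀ μ, (L μ)ᴴ * X = X * (L μ)ᴴ) →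
      liouvillianDual H L X = Complex.I • (H * X - X * H) := by
    intro X hX hX'
    rw [liouvillianDual, Finset.sum_eq_zero, add_zero]
    intro μ _
    rw [← mul_assoc X, ← hX' μ, mul_assoc, mul_assoc, hX μ, two_smul, sub_self]
  have hHX : H * Y - Y * H = (-Complex.I * z) • Y := by
    rw [mul_smul, ← hY, hunit Y h2 h5, smul_smul]
    simp
  have hzs : star z = -z := by
    apply Complex.ext <;> simp [hz]
  have hHX' : H * Yᴴ - Yᴴ * H = (Complex.I * z) • Yᴴ := by
    have : H * Yᴴ - Yᴴ * H = -Complex.I • (star z • Yᴴ) := by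
      rw [← hY', hunit Yᴴ h4 h6, smul_smul]
      simp
    rw [this, hzs, smul_smul, neg_mul_neg]
  have hmem : ∀ X : Matrix n n ℂ, H * X = X * H → (∀ μ, L μ * X = X * L μ) →
      (∀ μ, (L μ)ᴴ * X = X * (L μ)ᴴ) → ∃ c : ℂ, X = c • 1 := by
    intro X hX hX1 hX2
    obtain ⟨c, hc⟩ := hcomm (show X ∈ commutant H L by
      rw [commutant, Set.mem_centralizer_iff]
      rintro m ((rfl | ⟨μ, rfl⟩) | ⟨μ, rfl⟩)
      exacts [hX, hX1 μ, hX2 μ])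
    exact ⟨c, hc.symm⟩
  -- The phases of `Y` and `Yᴴ` cancel in the product, so it lies in the commutant. Being a nonzero
  -- scalar, it makes `Y` invertible.
  obtain ⟨c, hc⟩ := hmem (Yᴴ * Y)
    (by
      rw [← sub_eq_zero]
      calc _ = (H * Yᴴ - Yᴴ * H) * Y + Yᴴ * (H * Y - Y * H) := by noncomm_ring
        _ = 0 := by
          rw [hHX, hHX', Matrix.smul_mul, Matrix.mul_smul, ← add_smul]
          simp)
    (fun μ => by rw [← mul_assoc, h4, mul_assoc, h2, mul_assoc])
    (fun μ => by rw [← mul_assoc, h6, mul_assoc, h5, mul_assoc])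
  have hc0 : c ≠ 0 := by
    rintro rfl
    exact hY0 (conjTranspose_mul_self_eq_zero.1 (by simpa using hc))
  have hinv : Y * (c⁻¹ • Yᴴ) = 1 := by
    refine mul_eq_one_comm.1 ?_
    rw [Matrix.smul_mul, hc, smul_smul, inv_mul_cancel₀ hc0, one_smul]
  -- The trace of `H - Y H Y⁻¹` is zero, while the eigenvalue equation makes it `-i z` times the
  -- dimension.
  have hz0 : z = 0 := by
    have htr := congrArg (fun A => (A * (c⁻¹ • Yᴴ)).trace) hHX
    simp only [sub_mul, trace_sub] at htr
    rw [mul_assoc H, hinv, mul_one, trace_mul_comm (Y * H), ← mul_assoc, mul_eq_one_comm.1 hinv,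
      one_mul, sub_self, Matrix.smul_mul, hinv, trace_smul, trace_one] at htr
    simpa using htr.symm
  refine ⟨hz0, hmem Y ?_ h2 h5⟩
  rwa [hz0, mul_zero, zero_smul, sub_eq_zero] at hHX

end Liouvillian

/-! ### State bounds and the spectrum of the shifted generator -/

section Decay

open Matrix

/-- By spectral mapping `e^{t z}` lies in the spectrum of `exp (t b)`, so its modulus is bounded by
a multiple of `e^{-γ t}`; let `t → ∞`. -/
theorem re_le_of_norm_exp_smul_le {𝔸 : Type*} [NormedRing 𝔸] [NormedAlgebra ℂ 𝔸]
    [CompleteSpace 𝔸] [Nontrivial 𝔸] {b : 𝔸} {C γ : ℝ}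
    (hb : ∀ t : ℝ, 0 ≤ t → ‖NormedSpace.exp ((t : ℂ) • b)‖ ≤ C * Real.exp (-γ * t)) {z : ℂ}
    (hz : z ∈ spectrum ℂ b) : z.re ≤ -γ := by
  by_contra! hlt
  have hle : ∀ t : ℝ, 0 ≤ t → Real.exp ((z.re + γ) * t) ≤ C * ‖(1 : 𝔸)‖ := by
    intro t ht
    have hmem : (t : ℂ) • z ∈ spectrum ℂ ((t : ℂ) • b) := by
      rw [spectrum.smul_eq_smul _ _ ⟨z, hz⟩]
      exact Set.smul_mem_smul_set hz
    have h1 := spectrum.norm_le_norm_mul_of_mem (spectrum.exp_mem_exp _ hmem)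
    rw [← Complex.exp_eq_exp_ℂ, Complex.norm_exp, smul_eq_mul, Complex.re_ofReal_mul] at h1
    have h2 : Real.exp ((z.re + γ) * t) = Real.exp (t * z.re) * Real.exp (γ * t) := by
      rw [← Real.exp_add]; ring_nf
    have h3 : Real.exp (-γ * t) * Real.exp (γ * t) = 1 := by
      rw [← Real.exp_add]; simp
    rw [h2]
    calc _ ≤ C * Real.exp (-γ * t) * ‖(1 : 𝔸)‖ * Real.exp (γ * t) := by
          gcongr
          exact h1.trans (by gcongr; exact hb t ht)
      _ = C * ‖(1 : 𝔸)‖ * (Real.exp (-γ * t) * Real.exp (γ * t)) := by ring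
      _ = _ := by rw [h3, mul_one]
  have htend : Tendsto (fun t : ℝ => Real.exp ((z.re + γ) * t)) atTop atTop :=
    Real.tendsto_exp_atTop.comp (tendsto_id.const_mul_atTop (by linarith))
  obtain ⟨t, ht1, ht2⟩ := ((htend.eventually_gt_atTop (C * ‖(1 : 𝔸)‖)).and
    (eventually_ge_atTop 0)).exists
  exact absurd (hle t ht2) (not_le.2 ht1)

variable {n : Type*} [Fintype n]

/-- Writing `ρ = Bᴴ B`, the entry is at most `(ρ i i + ρ j j) / 2` in modulus. The bound makes later
estimates uniform over initial states. -/
theorem IsDensityOperator.norm_apply_le_one {ρ : Matrix n n ℂ} (hρ : IsDensityOperator ρ)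
    (i j : n) : ‖ρ i j‖ ≤ 1 := by
  classical
  obtain ⟨B, hB⟩ : ∃ B : Matrix n n ℂ, ρ = Bᴴ * B := by
    open scoped MatrixOrder in
    exact CStarAlgebra.nonneg_iff_eq_star_mul_self.1 hρ.1.nonneg
  have hdiag : ∀ i, (ρ i i).re = ∑ k, ‖B k i‖ ^ 2 := fun i => by
    rw [hB, mul_apply, Complex.re_sum]
    refine Finset.sum_congr rfl fun k _ => ?_
    rw [conjTranspose_apply, Complex.star_def, Complex.conj_mul', ← Complex.ofReal_pow,
      Complex.ofReal_re]
  have hle : ∀ i, ∑ k, ‖B k i‖ ^ 2 ≤ 1 := fun i => by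
    have htr : ∑ i, (ρ i i).re = 1 := by
      have := congrArg Complex.re hρ.2
      rwa [trace, Complex.re_sum] at this
    rw [← hdiag, ← htr]
    refine Finset.single_le_sum (f := fun i => (ρ i i).re) (fun i _ => ?_) (Finset.mem_univ i)
    rw [hdiag]
    positivity
  calc ‖ρ i j‖ ≤ ∑ k, ‖B k i‖ * ‖B k j‖ := by
        rw [hB, mul_apply]
        refine (norm_sum_le _ _).trans (Finset.sum_le_sum fun k _ => ?_)
        rw [norm_mul, conjTranspose_apply, norm_star]
    _ ≤ ∑ k, (‖B k i‖ ^ 2 + ‖B k j‖ ^ 2) / 2 := by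
        refine Finset.sum_le_sum fun k _ => ?_
        nlinarith [sq_nonneg (‖B k i‖ - ‖B k j‖)]
    _ ≤ 1 := by
        rw [← Finset.sum_div, Finset.sum_add_distrib]
        linarith [hle i, hle j]

variable [DecidableEq n]

theorem exists_forall_eq_trace_mul (φ : Module.Dual ℂ (Matrix n n ℂ)) :
    ∃ Y : Matrix n n ℂ, ∀ X, φ X = (Y * X).trace := by
  refine ⟨of fun i j => φ (single j i 1), fun X => ?_⟩
  conv_lhs => rw [matrix_eq_sum_single X]
  simp only [map_sum, trace, diag_apply, mul_apply, of_apply]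
  rw [Finset.sum_comm]
  refine Finset.sum_congr rfl fun i _ => Finset.sum_congr rfl fun j _ => ?_
  rw [← mul_one (X j i), ← smul_eq_mul, ← smul_single, map_smul, smul_eq_mul, smul_eq_mul,
    mul_one, mul_comm]

/-- The generator `𝓛` with the eigenvalue `0` of the stationary state `ρ` moved to `-1`. -/
noncomputable def shiftedGenerator (𝓛 : Module.End ℂ (Matrix n n ℂ)) (ρ : Matrix n n ℂ) :
    Module.End ℂ (Matrix n n ℂ) :=
  𝓛 - (traceLinearMap n ℂ ℂ).smulRight ρ

omit [DecidableEq n] in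
theorem shiftedGenerator_apply (𝓛 : Module.End ℂ (Matrix n n ℂ)) (ρ X : Matrix n n ℂ) :
    shiftedGenerator 𝓛 ρ X = 𝓛 X - X.trace • ρ := rfl

omit [DecidableEq n] in
theorem shiftedGenerator_mul_self {𝓛 : Module.End ℂ (Matrix n n ℂ)}
    (htr : ∀ X, (𝓛 X).trace = 0) (ρ : Matrix n n ℂ) :
    shiftedGenerator 𝓛 ρ * 𝓛 = 𝓛 * 𝓛 :=
  LinearMap.ext fun X => by
    simp [shiftedGenerator_apply, htr]

omit [DecidableEq n] in
-- Eigenvectors at nonzero eigenvalues are traceless, so the rank-one correction does not see them.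
theorem hasEigenvalue_shiftedGenerator {𝓛 : Module.End ℂ (Matrix n n ℂ)}
    (htr : ∀ X, (𝓛 X).trace = 0) (ρ : Matrix n n ℂ) {z : ℂ} (hz : z ≠ 0)
    (h : 𝓛.HasEigenvalue z) : (shiftedGenerator 𝓛 ρ).HasEigenvalue z := by
  obtain ⟨X, hX⟩ := h.exists_hasEigenvector
  have hX0 : X.trace = 0 := by
    have := htr X
    rw [hX.apply_eq_smul, trace_smul, smul_eq_mul] at this
    exact (mul_eq_zero.1 this).resolve_left hz
  refine Module.End.hasEigenvalue_of_hasEigenvector (x := X)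
    ⟨Module.End.mem_eigenspace_iff.2 ?_, hX.2⟩
  rw [shiftedGenerator_apply, hX0, zero_smul, sub_zero, hX.apply_eq_smul]

/-- A left eigenvector `Y` satisfies `𝓛†Y - tr(Y ρ) 1 = z Y`. Testing on `ρ` leaves either `z = -1`,
or `tr(Y ρ) = 0` and `Y` is an eigenvector of the dual generator; the scalar ones are then excluded
by `tr ρ = 1`. -/
theorem re_neg_of_mem_spectrum_shiftedGenerator {M : Type*} [Fintype M] [Nonempty n]
    {H : Matrix n n ℂ} (hH : H.IsHermitian) {L : M → Matrix n n ℂ} {ρ : Matrix n n ℂ}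
    (hρ : IsDensityOperator ρ) (hu : IsUnit ρ) (hstat : liouvillian H L ρ = 0)
    (hcomm : commutant H L ⊆ Set.range fun c : ℂ => c • (1 : Matrix n n ℂ)) {z : ℂ}
    (hz : z ∈ spectrum ℂ (shiftedGenerator (liouvillian H L) ρ)) : z.re < 0 := by
  -- In finite dimension a non-invertible map is not surjective, so some nonzero functional kills
  -- its range.
  rw [spectrum.mem_iff, ← IsUnit.neg_iff, neg_sub, LinearMap.isUnit_iff_range_eq_top] at hz
  obtain ⟨φ, hφ0, hφ⟩ := Submodule.exists_le_ker_of_lt_top _ (lt_top_iff_ne_top.2 hz)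
  obtain ⟨Y, hY⟩ := exists_forall_eq_trace_mul φ
  have hY0 : Y ≠ 0 := by
    rintro rfl
    exact hφ0 (LinearMap.ext fun X => by simp [hY])
  have hpair : ∀ X, (liouvillianDual H L Y * X).trace - X.trace * (Y * ρ).trace =
      z * (Y * X).trace := by
    intro X
    have := LinearMap.mem_ker.1 (hφ (LinearMap.mem_range_self _ X))
    rw [LinearMap.sub_apply, shiftedGenerator_apply, Module.algebraMap_end_apply, hY, mul_sub,
      mul_sub, trace_sub, trace_sub, trace_mul_liouvillian, Matrix.mul_smul, Matrix.mul_smul,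
      trace_smul, trace_smul, smul_eq_mul, smul_eq_mul, sub_eq_zero] at this
    exact this
  have hρpair := hpair ρ
  rw [← trace_mul_liouvillian, hstat, mul_zero, trace_zero, hρ.2, one_mul, zero_sub] at hρpair
  by_cases hYρ : (Y * ρ).trace = 0
  · have hdual : liouvillianDual H L Y = z • Y := by
      rw [ext_iff_trace_mul_right]
      intro X
      rw [Matrix.smul_mul, trace_smul, smul_eq_mul, ← hpair, hYρ, mul_zero, sub_zero]
    rcases eigenvalue_liouvillianDual hH hρ.1 hu hstat hcomm hY0 hdual with h | ⟨-, c, rfl⟩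
    · exact h
    · rw [Matrix.smul_mul, one_mul, trace_smul, hρ.2, smul_eq_mul, mul_one] at hYρ
      exact absurd (by rw [hYρ, zero_smul]) hY0
  · have hz1 : z = -1 := by
      refine mul_right_cancel₀ hYρ ?_
      rw [← hρpair, neg_one_mul]
    simp [hz1]

attribute [local instance] Matrix.linftyOpNormedRing Matrix.linftyOpNormedAlgebra

/-- The matrix of a linear map on operators in the basis of matrix units. -/
noncomputable abbrev superMatrix : Module.End ℂ (Matrix n n ℂ) ≃ₐ[ℂ] Matrix (n × n) (n × n) ℂ :=
  LinearMap.toMatrixAlgEquiv (stdBasis ℂ n n)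

omit [DecidableEq n] in
theorem stdBasis_repr_apply (X : Matrix n n ℂ) (p : n × n) :
    (stdBasis ℂ n n).repr X p = X p.1 p.2 := by
  simp [stdBasis]

theorem toLin_stdBasis_apply (E : Matrix (n × n) (n × n) ℂ) (X : Matrix n n ℂ) (i j : n) :
    toLin (stdBasis ℂ n n) (stdBasis ℂ n n) E X i j = (E *ᵥ fun p => X p.1 p.2) (i, j) := by
  have h := congrFun (repr_toLin (stdBasis ℂ n n) (stdBasis ℂ n n) E X) (i, j)
  rw [stdBasis_repr_apply] at h
  exact h.trans (congrArg (fun v => (E *ᵥ v) (i, j)) (funext (stdBasis_repr_apply X)))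

/-- The matrix norm here is the operator norm for the sup norm, in which the vectorized state has
norm at most `1`. -/
theorem norm_trace_mul_toLin_le {ρ₀ : Matrix n n ℂ} (hρ₀ : IsDensityOperator ρ₀)
    (O : Matrix n n ℂ) (E : Matrix (n × n) (n × n) ℂ) :
    ‖(O * toLin (stdBasis ℂ n n) (stdBasis ℂ n n) E ρ₀).trace‖ ≤ (∑ i, ∑ j, ‖O i j‖) * ‖E‖ := by
  rw [trace, Finset.sum_mul]
  refine (norm_sum_le _ _).trans (Finset.sum_le_sum fun i _ => ?_)
  rw [diag_apply, mul_apply, Finset.sum_mul]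
  refine (norm_sum_le _ _).trans (Finset.sum_le_sum fun j _ => ?_)
  rw [norm_mul, toLin_stdBasis_apply]
  gcongr
  refine (norm_le_pi_norm _ _).trans ((linfty_opNorm_mulVec _ _).trans ?_)
  refine mul_le_of_le_one_right (norm_nonneg _) ?_
  exact (pi_norm_le_iff_of_nonneg zero_le_one).2 fun p => hρ₀.norm_apply_le_one _ _

theorem continuousAt_superMatrix {𝓛 : ℝ → Module.End ℂ (Matrix n n ℂ)} {s₀ : ℝ}
    (h : ∀ X x y, ContinuousAt (fun s => 𝓛 s X x y) s₀) :
    ContinuousAt (fun s => superMatrix (𝓛 s)) s₀ := by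
  refine continuousAt_pi.2 fun p => continuousAt_pi.2 fun q => ?_
  simp only [superMatrix, LinearMap.toMatrixAlgEquiv_apply, stdBasis_repr_apply]
  exact h _ _ _

/-! ### Uniform gap and decay under perturbation -/

section Perturbation

variable {𝓛 : ℝ → Module.End ℂ (Matrix n n ℂ)} {ρ : Matrix n n ℂ} {s₀ : ℝ}

theorem continuousAt_superMatrix_shiftedGenerator
    (hcont : ∀ X x y, ContinuousAt (fun s => 𝓛 s X x y) s₀) :
    ContinuousAt (fun s => superMatrix (shiftedGenerator (𝓛 s) ρ)) s₀ := by
  refine continuousAt_superMatrix fun X x y => ?_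
  simp only [shiftedGenerator_apply, Matrix.sub_apply]
  exact (hcont X x y).sub continuousAt_const

/-- The shift uses one fixed `ρ` for all `s`: it need not be stationary for `𝓛 s`, since trace
annihilation alone transfers nonzero eigenvalues. -/
theorem exists_eventually_hasEigenvalue_re_le [Nonempty n]
    (hcont : ∀ X x y, ContinuousAt (fun s => 𝓛 s X x y) s₀)
    (hspec : ∀ z ∈ spectrum ℂ (shiftedGenerator (𝓛 s₀) ρ), z.re < 0) :
    ∃ γ : ℝ, 0 < γ ∧ ∀ᶠ s in 𝓝 s₀, (∀ X, (𝓛 s X).trace = 0) →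
      ∀ z, (𝓛 s).HasEigenvalue z → z ≠ 0 → z.re ≤ -γ := by
  obtain ⟨C, γ, -, hγ, hev⟩ := exists_eventually_norm_exp_smul_le
    (a := superMatrix (shiftedGenerator (𝓛 s₀) ρ))
    (fun z hz => hspec z (by rwa [AlgEquiv.spectrum_eq] at hz))
  refine ⟨γ, hγ, ?_⟩
  filter_upwards [(continuousAt_superMatrix_shiftedGenerator hcont).eventually hev]
    with s hs htr z hz hz0
  refine re_le_of_norm_exp_smul_le hs ?_
  rw [AlgEquiv.spectrum_eq]
  exact (hasEigenvalue_shiftedGenerator htr ρ hz0 hz).mem_spectrum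

theorem exists_eventually_expectation_sub_le [Nonempty n]
    (hcont : ∀ X x y, ContinuousAt (fun s => 𝓛 s X x y) s₀)
    (hspec : ∀ z ∈ spectrum ℂ (shiftedGenerator (𝓛 s₀) ρ), z.re < 0) (O : Matrix n n ℂ) :
    ∃ C γ : ℝ, 0 < γ ∧ ∀ᶠ s in 𝓝 s₀, (∀ X, (𝓛 s X).trace = 0) →
      ∀ ρ₀, IsDensityOperator ρ₀ → ∃ c : ℂ, ∀ t : ℝ, 0 ≤ t →
        ‖expectation (𝓛 s) O ρ₀ t - c‖ ≤ C * Real.exp (-γ * t) := by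
  have hspec' : ∀ z ∈ spectrum ℂ (superMatrix (shiftedGenerator (𝓛 s₀) ρ)), z.re < 0 :=
    fun z hz => hspec z (by rwa [AlgEquiv.spectrum_eq] at hz)
  obtain ⟨C, γ, hC0, hγ, hev⟩ := exists_eventually_norm_exp_smul_le hspec'
  have hAc := continuousAt_superMatrix hcont
  have hBc := continuousAt_superMatrix_shiftedGenerator (ρ := ρ) hcont
  set A := fun s => superMatrix (𝓛 s) with hA
  set B := fun s => superMatrix (shiftedGenerator (𝓛 s) ρ) with hB
  have hunit : IsUnit (B s₀) := spectrum.zero_notMem_iff ℂ |>.1 fun h0 => by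
    simpa using hspec' 0 h0
  obtain ⟨u, hu⟩ := hunit
  have hinv : ContinuousAt (fun s => Ring.inverse (B s) * A s) s₀ :=
    (ContinuousAt.comp (g := Ring.inverse) (by
      rw [← hu]; exact NormedRing.inverse_continuousAt u) hBc).mul hAc
  -- Inversion is continuous at the unit `B s₀`, so `K` bounds `B⁻¹ A` for all nearby `s`.
  set K := ‖Ring.inverse (B s₀) * A s₀‖ + 1
  refine ⟨(∑ i, ∑ j, ‖O i j‖) * (C * K), γ, hγ, ?_⟩
  filter_upwards [hBc.eventually hev,
    hBc.eventually (by rw [← hu]; exact Units.nhds u),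
    hinv.norm.eventually (gt_mem_nhds (lt_add_one _))] with s hs hsu hsK htr ρ₀ hρ₀
  have hBA : B s * A s = A s * A s := by
    simp only [hA, hB, ← map_mul, shiftedGenerator_mul_self htr]
  have hexp := exp_smul_eq_of_mul_self_eq hBA (Ring.mul_inverse_cancel _ hsu)
  refine ⟨(O * toLin (stdBasis ℂ n n) (stdBasis ℂ n n)
    (1 - Ring.inverse (B s) * A s) ρ₀).trace, fun t ht => ?_⟩
  have hevol : evolution (𝓛 s) t ρ₀ = toLin (stdBasis ℂ n n) (stdBasis ℂ n n)
      ((1 - Ring.inverse (B s) * A s) +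
        NormedSpace.exp ((t : ℂ) • B s) * (Ring.inverse (B s) * A s)) ρ₀ :=
    congrArg (fun E => toLin (stdBasis ℂ n n) (stdBasis ℂ n n) E ρ₀) (hexp t)
  rw [expectation, hevol, map_add,
    LinearMap.add_apply, mul_add, trace_add, add_sub_cancel_left]
  calc _ ≤ _ := norm_trace_mul_toLin_le hρ₀ _ _
    _ ≤ (∑ i, ∑ j, ‖O i j‖) * (C * Real.exp (-γ * t) * K) := by
        gcongr
        refine (norm_mul_le _ _).trans ?_
        gcongr
        exact hs t ht
    _ = _ := by ring

end Perturbation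

end Decay

/-! ### The three assertions -/

theorem theorem4 {ι : Type*} [Fintype ι] [DecidableEq ι] {κ : ι → Type*}
    [∀ i, Fintype (κ i)] [∀ i, DecidableEq (κ i)] {M : Type*} [Fintype M]
    (H : Matrix (∀ i, κ i) (∀ i, κ i) ℂ) (hH : H.IsHermitian)
    (L : M → Matrix (∀ i, κ i) (∀ i, κ i) ℂ)
    (hstat : ∃ ρinf : Matrix (∀ i, κ i) (∀ i, κ i) ℂ,
      IsDensityOperator ρinf ∧ IsUnit ρinf ∧ liouvillian H L ρinf = 0)
    (hcomm : commutant H L =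
      Set.range fun c : ℂ => c • (1 : Matrix (∀ i, κ i) (∀ i, κ i) ℂ)) :
    (∀ ω : ℝ, ω ≠ 0 → ¬ (liouvillian H L).HasEigenvalue (Complex.I * (ω : ℂ))) ∧
    (∀ (j k : ι) (e : κ j ≃ κ k) (O : Matrix (κ j) (κ j) ℂ),
      ¬ StablySynchronized (liouvillian H L) j k e O) ∧
    ∀ (S : Set ℝ) (𝓛 : ℝ → Module.End ℂ (Matrix (∀ i, κ i) (∀ i, κ i) ℂ)),
      𝓛 0 = liouvillian H L →
      (∀ X x y, AnalyticAt ℝ (fun s => 𝓛 s X x y) 0) →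
      (∀ s ∈ S, IsLiouvillian (𝓛 s)) →
      ¬ HasAlmostPurelyImaginaryEigenvalues 𝓛 S ∧
      ∀ (j k : ι) (e : κ j ≃ κ k) (O : Matrix (κ j) (κ j) ℂ),
        ¬ MetastablySynchronized 𝓛 S j k e O := by
  obtain ⟨ρ, hρ, hu, hstat⟩ := hstat
  have : Nonempty (∀ i, κ i) := by
    by_contra hempty
    rw [not_nonempty_iff] at hempty
    have := hρ.2
    rw [Matrix.trace_eq_zero_of_isEmpty] at this
    exact zero_ne_one this
  have hspec : ∀ z ∈ spectrum ℂ (shiftedGenerator (liouvillian H L) ρ), z.re < 0 := fun z hz =>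
    re_neg_of_mem_spectrum_shiftedGenerator hH hρ hu hstat hcomm.subset hz
  refine ⟨fun ω hω h => ?_, ?_, ?_⟩
  · have hz : Complex.I * (ω : ℂ) ≠ 0 := mul_ne_zero Complex.I_ne_zero (by exact_mod_cast hω)
    have := hspec _
      (hasEigenvalue_shiftedGenerator (trace_liouvillian H L) ρ hz h).mem_spectrum
    simp at this
  · rintro j k e O ⟨ρ₀, τ, hρ₀, hτ, -, hnot⟩
    -- The unperturbed case is the constant family.
    obtain ⟨C, γ, hγ, hev⟩ := exists_eventually_expectation_sub_le (s₀ := 0)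
      (𝓛 := fun _ => liouvillian H L) (fun _ _ _ => continuousAt_const) hspec (siteOperator j O)
    obtain ⟨c, hc⟩ := hev.self_of_nhds (trace_liouvillian H L) ρ₀ hρ₀
    exact hnot ⟨c, C, γ, hγ, fun t ht => hc t (hτ.trans ht)⟩
  · intro S 𝓛 h0 han hS
    have hcont : ∀ X x y, ContinuousAt (fun s => 𝓛 s X x y) 0 := fun X x y =>
      (han X x y).continuousAt
    have htr : ∀ᶠ s in 𝓝[S \ {0}] 0, ∀ X, (𝓛 s X).trace = 0 := by
      filter_upwards [self_mem_nhdsWithin] with s hs X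
      obtain ⟨H', m, L', -, h⟩ := hS s hs.1
      rw [h, trace_liouvillian]
    rw [← h0] at hspec
    refine ⟨fun halmost => ?_, ?_⟩
    · obtain ⟨γ, hγ, hev⟩ := exists_eventually_hasEigenvalue_re_le hcont hspec
      refine halmost γ hγ ?_
      filter_upwards [hev.filter_mono nhdsWithin_le_nhds, htr] with s hs hts
      rintro ⟨z, hz, hz0, hre⟩
      exact absurd (hs hts z hz hz0) (not_le.2 hre)
    · rintro j k e O ⟨ρ₀, τ, T, ε, hρ₀, hτ, -, -, -, -, hnot⟩
      obtain ⟨C, γ, hγ, hev⟩ := exists_eventually_expectation_sub_le hcont hspec (siteOperator j O)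
      have hex : ∀ᶠ s in 𝓝[S \ {0}] 0, ∃ c : ℂ, ∀ t ∈ Set.Icc (τ s) (T s),
          ‖expectation (𝓛 s) (siteOperator j O) (ρ₀ s) t - c‖ ≤ C * Real.exp (-γ * t) := by
        filter_upwards [hev.filter_mono nhdsWithin_le_nhds, htr] with s hs hts
        obtain ⟨c, hc⟩ := hs hts (ρ₀ s) (hρ₀ s)
        exact ⟨c, fun t ht => hc t ((hτ s).trans ht.1)⟩
      -- The limiting constant depends on `s`, whereas `C` and `γ` do not, as the definition
      -- demands.
      obtain ⟨c, hc⟩ := Filter.skolem.1 hex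
      exact hnot ⟨c, C, γ, hγ, hc⟩
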